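/- **Theorem.** Let $m\ge 2$ agents form a network and let $W\in\mathbb R^{m\times m}$ be a symmetric matrix with $W_{ij}\ne 0$ if and only if $i=j$ or $i,j$ are connected by an edge, $0\preceq W\preceq I$, $W\mathbf 1=\mathbf 1$ and $\mathrm{null}(I-W)=\mathrm{span}(\mathbf 1)$; let $\lambda_2=\lambda_2(W)$ be its second largest eigenvalue. Let $L>0$, let each $f_i:\mathbb R^d\to\mathbb R$ $(1\le i\le m)$ be differentiable, convex and $L$-smooth, i.e. $0\le f_i(y)-f_i(x)-\langle\nabla f_i(x),y-x\rangle\le\frac L2\|x-y\|^2$ for all $x,y$, let $g:\mathbb R^d\to\mathbb R$ be convex, put $F(x)=\frac1m\sum_{i=1}^m f_i(x)+g(x)$, and let $x^*$ be a minimizer of $F$. For $\mathbf x\in\mathbb R^{m\times d}$ with rows $\mathbf x^{(i)}$ let $\|\mathbf x\|$ be the Frobenius norm, $\overline x=\frac1m\sum_i\mathbf x^{(i)}$, $\Pi=I-\frac1m\mathbf 1\mathbf 1^\top$, $\nabla f(\mathbf x)$ the matrix with rows $\nabla f_i(\mathbf x^{(i)})$, and $\mathrm{prox}_{\gamma g}(\mathbf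 x)$ the matrix with rows $\mathrm{argmin}_w\{\gamma g(w)+\frac12\|w-\mathbf x^{(i)}\|^2\}$. Let $\mathrm{FastMix}(\mathbf x,K)=\mathbf x^K$, where $\mathbf x^0=\mathbf x^1=\mathbf x$, $\mathbf x^{k+1}=(1+\eta)W\mathbf x^k-\eta\,\mathbf x^{k-1}$ and $\eta=1/(1+\sqrt{1-\lambda_2^2})$. Let $c_f=200$, $\gamma_t=\frac{t+4}{2Lc_f}$, $\tau_t=\frac1{Lc_f\gamma_t}=\frac2{t+4}$, and let $K$ be an integer with $K\ge 15/\sqrt{1-\lambda_2}$ (for instance $K=\lceil 15/\sqrt{1-\lambda_2}\,\rceil$). Starting from $x_1\in\mathbb R^d$, set $\mathbf x_1=\mathbf y_1=\mathbf z_1=\mathbf 1x_1$, $\mathbf s_1=\nabla f(\mathbf x_1)$ and, for $t\ge1$, $$\mathbf x_{t+1}=\tau_t\mathbf z_t+(1-\tau_t)\mathbf y_t,\qquad \mathbf s_{t+1}=\mathrm{FastMix}(\mathbf s_t+\nabla f(\mathbf x_{t+1})-\nabla f(\mathbf x_t),K),$$ $$\mathbf z_{t+1}=\mathrm{FastMix}(\mathrm{prox}_{\gamma_t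 g}(\mathbf z_t-\gamma_t\mathbf s_{t+1}),K),\qquad \mathbf y_{t+1}=\mathrm{FastMix}(\tau_t\mathbf z_{t+1}+(1-\tau_t)\mathbf y_t,K).$$ Then for every $T\ge 2$ $$F(\overline y_T)-F(x^*)\le\frac{15}{(T+3)^2}\big(F(\overline y_1)-F(x^*)\big)+\frac{2Lc_f}{m(T+3)^2}\|\mathbf z_1-\mathbf 1x^*\|^2+\frac{50L}{m(T+3)^2}\Big(\|\Pi\mathbf x_1\|^2+\frac{9\tau_1^2}{32}\|\Pi\mathbf z_1\|^2+\frac{5}{14L^2c_f^2}\|\Pi\mathbf s_1\|^2\Big).$$ -/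

import Mathlib

noncomputable section

namespace ODAPG

/-- The space of decision vectors, with its Euclidean norm. -/
abbrev Vec (d : ℕ) := EuclideanSpace ℝ (Fin d)

/-- An `m × d` real matrix, given by its `m` rows (one local copy for each agent). The norm used on
it is `frobSq` below, never the default sup norm of a function space. -/
abbrev Rows (m d : ℕ) := Fin m → Vec d

variable {m d : ℕ}

/-- The squared Frobenius norm `‖x‖²`. -/
def frobSq (x : Rows m d) : ℝ := ∑ i, ‖x i‖ ^ 2

/-- The matrix product `A x` of an `m × m` matrix with an `m × d` matrix. -/
def mulRows (A : Matrix (Fin m) (Fin m) ℝ) (x : Rows m d) : Rows m d :=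
  fun i => ∑ j, A i j • x j

/-- The average `(1/m) 1ᵀ x` of the rows. -/
def avg (x : Rows m d) : Vec d := (1 / (m : ℝ)) • ∑ i, x i

/-- The matrix `1 v` all of whose rows equal `v`. -/
def constRows (m : ℕ) (v : Vec d) : Rows m d := fun _ => v

/-- The projection matrix `Π = I - 1 1ᵀ / m`. -/
def centering (m : ℕ) : Matrix (Fin m) (Fin m) ℝ :=
  1 - (1 / (m : ℝ)) • Matrix.of fun _ _ => (1 : ℝ)

/-- `f` is differentiable, convex and `L`-smooth. -/
structure IsConvexSmooth (L : ℝ) (f : Vec d → ℝ) : Prop where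
  differentiable : Differentiable ℝ f
  lower : ∀ x y, f x + inner ℝ (gradient f x) (y - x) ≤ f y
  upper : ∀ x y, f y ≤ f x + inner ℝ (gradient f x) (y - x) + L / 2 * ‖x - y‖ ^ 2

/-- The composite objective `F(x) = (1/m) ∑ᵢ fᵢ(x) + g(x)`. -/
def objective (f : Fin m → Vec d → ℝ) (g : Vec d → ℝ) (x : Vec d) : ℝ :=
  (1 / (m : ℝ)) * ∑ i, f i x + g x

/-- `W` is a weight matrix for the network `G`: `0 ⪯ W ⪯ I` (in particular `W` is symmetric),
`W i j ≠ 0` exactly when `i = j` or `i`, `j` are connected by an edge, `W 1 = 1` and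
`null (I - W) = span (1)`. -/
structure IsWeightMatrix (G : SimpleGraph (Fin m)) (W : Matrix (Fin m) (Fin m) ℝ) : Prop where
  posSemidef : W.PosSemidef
  le_one : (1 - W).PosSemidef
  support : ∀ i j, W i j ≠ 0 ↔ (G.Adj i j ∨ i = j)
  mulVec_one : W.mulVec 1 = 1
  null_eq : LinearMap.ker (Matrix.mulVecLin (1 - W)) = Submodule.span ℝ {(1 : Fin m → ℝ)}

/-- The second largest eigenvalue (with multiplicity) of a symmetric matrix:
`Matrix.IsHermitian.eigenvalues₀` lists the eigenvalues in decreasing order. -/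
def lambda2 (hm : 2 ≤ m) {W : Matrix (Fin m) (Fin m) ℝ} (hW : W.IsHermitian) : ℝ :=
  hW.eigenvalues₀ ⟨1, by rw [Fintype.card_fin]; omega⟩

/-- The parameter `η_w = 1 / (1 + √(1 - λ₂²))` of `FastMix`. -/
def mixParam (lam : ℝ) : ℝ := 1 / (1 + Real.sqrt (1 - lam ^ 2))

/-- `FastMix`: `x⁰ = x¹ = x`, `xᵏ⁺¹ = (1 + η) W xᵏ - η xᵏ⁻¹`; the output after `K` rounds
is `x^K`. -/
def fastMix (W : Matrix (Fin m) (Fin m) ℝ) (η : ℝ) (x : Rows m d) : ℕ → Rows m d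
  | 0 => x
  | 1 => x
  | k + 2 => (1 + η) • mulRows W (fastMix W η x (k + 1)) - η • fastMix W η x k

/-- `prox_{γ g}(x)`, the minimizer of `w ↦ γ g(w) + ‖w - x‖² / 2`; it exists and is unique for
`γ > 0` and `g` convex. -/
def prox (γ : ℝ) (g : Vec d → ℝ) (x : Vec d) : Vec d :=
  Classical.epsilon fun w =>
    ∀ u, γ * g w + 1 / 2 * ‖w - x‖ ^ 2 ≤ γ * g u + 1 / 2 * ‖u - x‖ ^ 2

/-- The aggregated proximal operator, acting row by row. -/
def proxRows (γ : ℝ) (g : Vec d → ℝ) (x : Rows m d) : Rows m d := fun i => prox γ g (x i)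

/-- The aggregated gradient, whose `i`-th row is `∇fᵢ(xⁱ)`. -/
def gradRows (f : Fin m → Vec d → ℝ) (x : Rows m d) : Rows m d := fun i => gradient (f i) (x i)

/-- The variables of the algorithm. -/
structure State (m d : ℕ) where
  x : Rows m d
  y : Rows m d
  z : Rows m d
  s : Rows m d

/-- The initialization `z₁ = y₁ = x₁ = 1 x₁`, `s₁ⁱ = ∇fᵢ(x₁)`. -/
def initState (f : Fin m → Vec d → ℝ) (x₁ : Vec d) : State m d where
  x := constRows m x₁
  y := constRows m x₁
  z := constRows m x₁
  s := gradRows f (constRows m x₁)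

/-- One iteration with step sizes `γ`, `τ`, and `mix` as the averaging operator. -/
def step (mix : Rows m d → Rows m d) (f : Fin m → Vec d → ℝ) (g : Vec d → ℝ) (γ τ : ℝ)
    (S : State m d) : State m d :=
  let x' := τ • S.z + (1 - τ) • S.y
  let s' := mix (S.s + gradRows f x' - gradRows f S.x)
  let z' := mix (proxRows γ g (S.z - γ • s'))
  let y' := mix (τ • z' + (1 - τ) • S.y)
  { x := x', y := y', z := z', s := s' }

/-- The state `(x_t, y_t, z_t, s_t)` at time `t ≥ 1`; the initial state is that at time `1`
(the value at `t = 0` is a placeholder). -/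
def run (mix : Rows m d → Rows m d) (f : Fin m → Vec d → ℝ) (g : Vec d → ℝ) (γ τ : ℕ → ℝ)
    (x₁ : Vec d) : ℕ → State m d
  | 0 => initState f x₁
  | 1 => initState f x₁
  | t + 2 => step mix f g (γ (t + 1)) (τ (t + 1)) (run mix f g γ τ x₁ (t + 1))

end ODAPG

end

noncomputable section

namespace ODAPG

variable {m d : ℕ}

/-! ### Contraction of the scalar `FastMix` recursion -/

/-! Averaged over the agents, the scheme is an accelerated proximal gradient method with inexact
data. Mixing preserves averages (`avg_fastMix`), and gradient tracking keeps the average of `s`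
equal to the average local gradient (`avg_step_s`). Smoothness, convexity and the proximal
inequality therefore give the usual one-step estimate, with errors made of deviations from the
averages (`objective_step_le`). Weighting by `1 / τ²` turns it into a Lyapunov inequality
(`lyapunov_step_le`). Its negative terms are kept: the deviation of the proximal point, the movement
of the average of `z`, and a gradient variation coming from cocoercivity.

In an eigenbasis of `W`, `FastMix` acts by the scalar polynomials `mixPoly`. The eigenvalue `1` is
simple with constant eigenvector, and the other eigenvalues lie in `[0, λ₂]`, where the recursion is
oscillatory and decays like `√η ^ K`. The choice of `K` makes squared deviations shrink by `2⁻¹³`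
(`frobSq_dev_fastMix_le`).

After such a contraction every deviation is a small multiple of earlier deviations and of the
negative terms, so these absorb the errors (`consensus_error_bound`). Since `x`, `y`, `z` start with
equal rows, only the initial deviation of `s` survives. The Lyapunov weights telescope in
`accelerated_rate`. -/

/-- The scalar `FastMix` recursion for the eigenvalue `μ`. -/
def mixPoly (η μ : ℝ) : ℕ → ℝ
  | 0 => 1
  | 1 => 1
  | k + 2 => (1 + η) * μ * mixPoly η μ (k + 1) - η * mixPoly η μ k

/-- By the recursion the left side is the Casoratian `p (k+1) ^ 2 - p k * p (k+2)`, which is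
multiplied at each step by `η`, the product of the characteristic roots. -/
lemma mixPoly_energy (η μ : ℝ) (k : ℕ) :
    mixPoly η μ (k + 1) ^ 2 + η * mixPoly η μ k ^ 2
      - (1 + η) * μ * mixPoly η μ (k + 1) * mixPoly η μ k = η ^ k * ((1 + η) * (1 - μ)) := by
  induction k with
  | zero => simp [mixPoly]; ring
  | succ k ih =>
    rw [show η ^ (k + 1) * ((1 + η) * (1 - μ)) = η * (η ^ k * ((1 + η) * (1 - μ))) by ring, ← ih,
      mixPoly]
    ring

/-- For `η = 1 / (1 + s)` this quantity is, up to a positive factor, minus the discriminant of the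
characteristic equation. The roots are thus complex, of modulus `√η`, and the energy form is
positive definite. -/
lemma mixPoly_disc_pos {s μ : ℝ} (hs : 0 < s) (hμ : μ ^ 2 ≤ 1 - s ^ 2) :
    0 < 4 * (1 + s) - (2 + s) ^ 2 * μ ^ 2 := by
  have h1 : (2 + s) ^ 2 * μ ^ 2 ≤ (2 + s) ^ 2 * (1 - s ^ 2) := by gcongr
  have h2 : 0 < s ^ 2 * (3 + 4 * s + s ^ 2) := by positivity
  linarith [h1, h2, show 4 * (1 + s) - (2 + s) ^ 2 * (1 - s ^ 2) = s ^ 2 * (3 + 4 * s + s ^ 2) by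
    ring]

/-- Compares the initial energy with the discriminant, so that the bound on `mixPoly` has the
constant `2` even as `λ₂ → 1`. With `v = (2 + s) μ` the claim reads `v (v - 2) ≤ 2 s`; the left side
is nonpositive for `v ≤ 2` and increasing beyond, so only `μ = lam` matters. -/
lemma mixPoly_disc_lower {s lam μ : ℝ} (hs : 0 < s) (hl : 0 ≤ lam) (hl1 : lam ≤ 1)
    (hsl : s ^ 2 = 1 - lam ^ 2) (hμ0 : 0 ≤ μ) (hμ : μ ≤ lam) :
    4 * (2 + s) * (1 - μ) ≤ 2 * (4 * (1 + s) - (2 + s) ^ 2 * μ ^ 2) := by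
  have hs1 : s ≤ 1 := by nlinarith
  have hlam : 1 - s ^ 2 ≤ lam := by nlinarith
  have key : 2 * (2 + s) ≤ (1 + lam) * ((1 + s) * (3 + s)) := by
    have h1 : (2 - s ^ 2) * ((1 + s) * (3 + s)) ≤ (1 + lam) * ((1 + s) * (3 + s)) := by
      gcongr ?_ * _; linarith
    have h2 : s ^ 3 ≤ 1 := pow_le_one₀ hs.le hs1
    have h3 : s ^ 4 ≤ 1 := pow_le_one₀ hs.le hs1
    nlinarith
  have end_lam : (2 + s) * lam * ((2 + s) * lam - 2) ≤ 2 * s := by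
    have h1 := mul_le_mul_of_nonneg_left key (sub_nonneg.2 hl1)
    have h2 : (2 + s) ^ 2 * lam ^ 2 = (2 + s) ^ 2 * (1 - s ^ 2) := by rw [hsl]; ring
    have h3 : (1 - lam) * ((1 + lam) * ((1 + s) * (3 + s))) = s ^ 2 * ((1 + s) * (3 + s)) := by
      rw [hsl]; ring
    linarith
  have hv : (2 + s) * μ ≤ (2 + s) * lam := by gcongr
  have hv0 : 0 ≤ (2 + s) * μ := by positivity
  have main : (2 + s) * μ * ((2 + s) * μ - 2) ≤ 2 * s := by
    by_cases h : (2 + s) * μ ≤ 2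
    · have := mul_nonneg hv0 (sub_nonneg.2 h)
      linarith
    · push Not at h
      refine le_trans ?_ end_lam
      gcongr
  linarith

lemma mixPoly_sq_le {s lam μ : ℝ} (hs : 0 < s) (hl : 0 ≤ lam) (hl1 : lam ≤ 1)
    (hsl : s ^ 2 = 1 - lam ^ 2) (hμ0 : 0 ≤ μ) (hμ : μ ≤ lam) (k : ℕ) :
    mixPoly (1 / (1 + s)) μ (k + 1) ^ 2 ≤ 2 * (1 / (1 + s)) ^ k := by
  have hD := mixPoly_disc_pos hs (μ := μ) (by rw [hsl]; nlinarith)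
  have hE := mixPoly_energy (1 / (1 + s)) μ k
  have hL := mixPoly_disc_lower hs hl hl1 hsl hμ0 hμ
  set a := mixPoly (1 / (1 + s)) μ (k + 1)
  set b := mixPoly (1 / (1 + s)) μ k
  have hp : 0 < (1 / (1 + s)) ^ k := by positivity
  set P := (1 / (1 + s)) ^ k
  have h1 : a ^ 2 * (1 + s) + b ^ 2 - (2 + s) * μ * a * b = P * ((2 + s) * (1 - μ)) := by
    field_simp at hE
    linear_combination hE
  have h2 : a ^ 2 * (4 * (1 + s) - (2 + s) ^ 2 * μ ^ 2) ≤ 4 * (P * ((2 + s) * (1 - μ))) := by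
    rw [← h1]
    linarith [sq_nonneg ((2 + s) * μ * a - 2 * b), show
      4 * (a ^ 2 * (1 + s) + b ^ 2 - (2 + s) * μ * a * b) -
        a ^ 2 * (4 * (1 + s) - (2 + s) ^ 2 * μ ^ 2) = ((2 + s) * μ * a - 2 * b) ^ 2 by ring]
  have h3 := mul_le_mul_of_nonneg_left hL hp.le
  refine le_of_mul_le_mul_right (h2.trans ?_) hD
  linarith

/-- Bernoulli's inequality with exponent `1 / s ≥ 1` gives `(1 + s) ^ (1 / s) ≥ 2`, and `K ≥ 15 / δ
≥ 15 / s`. -/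
lemma two_pow_le_one_add_pow {s δ : ℝ} (hδ : 0 < δ) (hs : δ ≤ s) (hs1 : s ≤ 1) {K : ℕ}
    (hK : 15 / δ ≤ K) : (2 : ℝ) ^ 15 ≤ (1 + s) ^ K := by
  have hs0 : 0 < s := hδ.trans_le hs
  have h1 : (2 : ℝ) ≤ (1 + s) ^ (1 / s) := by
    have := one_add_mul_self_le_rpow_one_add (by linarith : (-1 : ℝ) ≤ s)
      (p := 1 / s) (by rw [le_div_iff₀ hs0]; linarith)
    rw [one_div_mul_cancel hs0.ne'] at this
    linarith
  calc (2 : ℝ) ^ 15 ≤ ((1 + s) ^ (1 / s)) ^ 15 := by gcongr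
    _ = (1 + s) ^ (15 / s) := by
      rw [← Real.rpow_natCast, ← Real.rpow_mul (by linarith)]
      congr 1
      push_cast
      ring
    _ ≤ (1 + s) ^ (K : ℝ) := by
      refine Real.rpow_le_rpow_of_exponent_le (by linarith) (le_trans ?_ hK)
      gcongr
    _ = (1 + s) ^ K := Real.rpow_natCast _ _

lemma mixPoly_contraction {lam μ : ℝ} (hl : 0 ≤ lam) (hl1 : lam < 1) {K : ℕ}
    (hK : 15 / Real.sqrt (1 - lam) ≤ K) (hμ0 : 0 ≤ μ) (hμ : μ ≤ lam) :
    mixPoly (mixParam lam) μ K ^ 2 ≤ 1 / 8192 := by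
  have hpos : 0 < 1 - lam ^ 2 := by nlinarith
  have hs : 0 < Real.sqrt (1 - lam ^ 2) := Real.sqrt_pos.2 hpos
  have hδ : 0 < Real.sqrt (1 - lam) := Real.sqrt_pos.2 (by linarith)
  have hδs : Real.sqrt (1 - lam) ≤ Real.sqrt (1 - lam ^ 2) := Real.sqrt_le_sqrt (by nlinarith)
  have hs1 : Real.sqrt (1 - lam ^ 2) ≤ 1 := by
    exact Real.sqrt_le_one.2 (by nlinarith)
  have hsl : Real.sqrt (1 - lam ^ 2) ^ 2 = 1 - lam ^ 2 := Real.sq_sqrt hpos.le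
  have h15 := two_pow_le_one_add_pow hδ hδs hs1 hK
  unfold mixParam
  set s := Real.sqrt (1 - lam ^ 2)
  obtain _ | k := K
  · norm_num at h15
  · refine (mixPoly_sq_le hs hl hl1.le hsl hμ0 hμ k).trans ?_
    rw [one_div_pow, mul_one_div, div_le_div_iff₀ (by positivity) (by norm_num)]
    -- The recursion contracts only `K - 1` times; the missing factor costs at most `2`, so the
    -- square is at most `4 / 2 ^ 15 = 1 / 8192`.
    have hk : (1 + s) ^ (k + 1) ≤ 2 * (1 + s) ^ k := by
      rw [pow_succ']; gcongr; linarith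
    linarith

/-! ### Averages and deviations of the rows -/

/-- The deviation `Π x` of the rows from their average. -/
def dev (x : Rows m d) : Rows m d := fun i => x i - avg x

lemma frobSq_nonneg (x : Rows m d) : 0 ≤ frobSq x := Finset.sum_nonneg fun _ _ => sq_nonneg _

lemma frobSq_smul (c : ℝ) (x : Rows m d) : frobSq (c • x) = c ^ 2 * frobSq x := by
  simp [frobSq, norm_smul, mul_pow, Finset.mul_sum]

lemma frobSq_add_le (x y : Rows m d) : frobSq (x + y) ≤ 2 * frobSq x + 2 * frobSq y := by
  simp only [frobSq, Finset.mul_sum, ← Finset.sum_add_distrib]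
  refine Finset.sum_le_sum fun i _ => ?_
  have := parallelogram_law_with_norm ℝ (x i) (y i)
  have h := norm_nonneg (x i - y i)
  simp only [Pi.add_apply]
  nlinarith

lemma frobSq_add_add_le (x y w : Rows m d) :
    frobSq (x + y + w) ≤ 4 * frobSq x + 4 * frobSq y + 2 * frobSq w := by
  linarith [frobSq_add_le (x + y) w, frobSq_add_le x y]

lemma avg_add (x y : Rows m d) : avg (x + y) = avg x + avg y := by
  simp [avg, Finset.sum_add_distrib]

lemma avg_sub (x y : Rows m d) : avg (x - y) = avg x - avg y := by
  simp [avg, Finset.sum_sub_distrib, smul_sub]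

lemma avg_smul (c : ℝ) (x : Rows m d) : avg (c • x) = c • avg x := by
  simp [avg, ← Finset.smul_sum, smul_comm c]

lemma sum_rows (hm : 0 < m) (x : Rows m d) : ∑ i, x i = (m : ℝ) • avg x := by
  have : (m : ℝ) ≠ 0 := by positivity
  simp [avg, smul_smul, this]

lemma avg_constRows (hm : 0 < m) (v : Vec d) : avg (constRows m v) = v := by
  have : (m : ℝ) ≠ 0 := by positivity
  simp [avg, constRows, ← Nat.cast_smul_eq_nsmul ℝ, smul_smul, this]

lemma dev_add (x y : Rows m d) : dev (x + y) = dev x + dev y := by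
  ext1 i; simp only [dev, avg_add, Pi.add_apply]; abel

lemma dev_smul (c : ℝ) (x : Rows m d) : dev (c • x) = c • dev x := by
  ext1 i; simp only [dev, avg_smul, Pi.smul_apply, smul_sub]

lemma dev_constRows (hm : 0 < m) (v : Vec d) : dev (constRows m v) = 0 := by
  ext1 i; simp [dev, avg_constRows hm, constRows]

lemma sum_dev (hm : 0 < m) (x : Rows m d) : ∑ i, dev x i = 0 := by
  simp only [dev]
  rw [Finset.sum_sub_distrib, sum_rows hm, Finset.sum_const, Finset.card_univ, Fintype.card_fin,
    ← Nat.cast_smul_eq_nsmul ℝ, sub_self]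

lemma frobSq_sub_constRows (hm : 0 < m) (x : Rows m d) (v : Vec d) :
    frobSq (x - constRows m v) = m * ‖avg x - v‖ ^ 2 + frobSq (dev x) := by
  have h : ∀ i, ‖(x - constRows m v) i‖ ^ 2
      = ‖avg x - v‖ ^ 2 + ‖dev x i‖ ^ 2 + 2 * inner ℝ (dev x i) (avg x - v) := by
    intro i
    rw [show (x - constRows m v) i = dev x i + (avg x - v) by simp [dev, constRows],
      norm_add_sq_real]
    ring
  simp only [frobSq, h, Finset.sum_add_distrib, ← Finset.mul_sum, ← sum_inner, sum_dev hm]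
  simp

lemma frobSq_dev_le (hm : 0 < m) (x : Rows m d) : frobSq (dev x) ≤ frobSq x := by
  have h := frobSq_sub_constRows hm x 0
  rw [show x - constRows m 0 = x by ext1 i; simp [constRows]] at h
  have : 0 ≤ (m : ℝ) * ‖avg x - 0‖ ^ 2 := by positivity
  linarith

lemma mul_norm_avg_sq_le (hm : 0 < m) (x : Rows m d) : m * ‖avg x‖ ^ 2 ≤ frobSq x := by
  have h := frobSq_sub_constRows hm x 0
  rw [show x - constRows m 0 = x by ext1 i; simp [constRows], sub_zero] at h
  linarith [frobSq_nonneg (dev x)]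

lemma mulRows_centering (x : Rows m d) : mulRows (centering m) x = dev x := by
  ext1 i
  simp [mulRows, centering, dev, avg, sub_smul, Finset.sum_sub_distrib, Matrix.one_apply,
    ← Finset.smul_sum]

/-! ### Coordinates of the rows in an orthonormal basis -/

/-- The coordinate of the rows `x` along the vector `v`, that is, the row vector `vᵀ x`. -/
def coef (v : EuclideanSpace ℝ (Fin m)) (x : Rows m d) : Vec d := ∑ i, v i • x i

lemma coef_sub (v : EuclideanSpace ℝ (Fin m)) (x y : Rows m d) :
    coef v (x - y) = coef v x - coef v y := by
  simp [coef, smul_sub, Finset.sum_sub_distrib]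

lemma coef_smul (v : EuclideanSpace ℝ (Fin m)) (c : ℝ) (x : Rows m d) :
    coef v (c • x) = c • coef v x := by
  simp [coef, Finset.smul_sum, smul_comm c]

/-- Parseval's identity, applied to each column of the matrix. -/
lemma sum_norm_coef_sq (b : OrthonormalBasis (Fin m) ℝ (EuclideanSpace ℝ (Fin m)))
    (x : Rows m d) : ∑ j, ‖coef (b j) x‖ ^ 2 = frobSq x := by
  simp only [frobSq, EuclideanSpace.norm_sq_eq]
  rw [Finset.sum_comm]
  symm
  rw [Finset.sum_comm]
  refine Finset.sum_congr rfl fun l _ => ?_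
  have h := b.sum_sq_norm_inner_right (WithLp.toLp 2 fun i => x i l)
  rw [EuclideanSpace.norm_sq_eq] at h
  refine Eq.trans h.symm (Finset.sum_congr rfl fun j _ => ?_)
  simp [coef, PiLp.inner_apply, mul_comm]

lemma coef_mulRows {W : Matrix (Fin m) (Fin m) ℝ} (hW : W.IsHermitian)
    {v : EuclideanSpace ℝ (Fin m)} {μ : ℝ} (hv : W.mulVec v = μ • (v : Fin m → ℝ))
    (x : Rows m d) : coef v (mulRows W x) = μ • coef v x := by
  simp only [coef, mulRows, Finset.smul_sum, smul_smul]
  rw [Finset.sum_comm]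
  refine Finset.sum_congr rfl fun k _ => ?_
  rw [← Finset.sum_smul]
  congr 1
  have h := congrFun hv k
  simp only [Matrix.mulVec, dotProduct, Pi.smul_apply, smul_eq_mul] at h
  rw [← h]
  refine Finset.sum_congr rfl fun i _ => ?_
  rw [← hW.apply i k]
  simp [mul_comm]

lemma coef_fastMix {W : Matrix (Fin m) (Fin m) ℝ} (hW : W.IsHermitian)
    {v : EuclideanSpace ℝ (Fin m)} {μ : ℝ} (hv : W.mulVec v = μ • (v : Fin m → ℝ))
    (η : ℝ) (x : Rows m d) : ∀ k, coef v (fastMix W η x k) = mixPoly η μ k • coef v x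
  | 0 => by simp [fastMix, mixPoly]
  | 1 => by simp [fastMix, mixPoly]
  | k + 2 => by
    rw [fastMix, mixPoly, coef_sub, coef_smul, coef_smul, coef_mulRows hW hv,
      coef_fastMix hW hv η x k, coef_fastMix hW hv η x (k + 1), sub_smul, smul_smul, smul_smul,
      smul_smul, mul_assoc]

lemma coef_constRows (v : EuclideanSpace ℝ (Fin m)) (u : Vec d) :
    coef v (constRows m u) = (∑ i, v i) • u := by
  simp [coef, constRows, Finset.sum_smul]

lemma coef_dev (v : EuclideanSpace ℝ (Fin m)) (x : Rows m d) :
    coef v (dev x) = coef v x - (∑ i, v i) • avg x := by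
  rw [← coef_constRows, ← coef_sub]
  rfl

lemma coef_dev_of_const (hm : 0 < m) {v : EuclideanSpace ℝ (Fin m)} {c : ℝ} (hv : ∀ i, v i = c)
    (x : Rows m d) : coef v (dev x) = 0 := by
  simp only [coef, hv, ← Finset.smul_sum, sum_dev hm, smul_zero]

/-! ### Averages under `FastMix` -/

namespace IsWeightMatrix

variable {G : SimpleGraph (Fin m)} {W : Matrix (Fin m) (Fin m) ℝ}

lemma avg_mulRows (hW : IsWeightMatrix G W) (x : Rows m d) : avg (mulRows W x) = avg x := by
  have h := coef_mulRows hW.posSemidef.isHermitian (v := WithLp.toLp 2 1) (μ := 1)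
    (by simpa using hW.mulVec_one) x
  simp only [coef, Pi.one_apply, one_smul] at h
  simp only [avg, h]

lemma avg_fastMix (hW : IsWeightMatrix G W) (η : ℝ) (x : Rows m d) :
    ∀ k, avg (fastMix W η x k) = avg x
  | 0 => rfl
  | 1 => rfl
  | k + 2 => by
    rw [fastMix, avg_sub, avg_smul, avg_smul, hW.avg_mulRows, hW.avg_fastMix η x k,
      hW.avg_fastMix η x (k + 1), add_smul, one_smul, add_sub_cancel_right]

/-! ### The spectrum of a weight matrix -/

lemma eigenvalue_le_one (hW : IsWeightMatrix G W) (j : Fin m) :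
    hW.posSemidef.isHermitian.eigenvalues j ≤ 1 := by
  set hH := hW.posSemidef.isHermitian
  have h := hW.le_one.re_dotProduct_nonneg (hH.eigenvectorBasis j)
  rw [Matrix.sub_mulVec, Matrix.one_mulVec, hH.mulVec_eigenvectorBasis j] at h
  have hn : ‖hH.eigenvectorBasis j‖ ^ 2 = 1 := by simp
  rw [EuclideanSpace.norm_sq_eq] at hn
  have h2 : (hH.eigenvectorBasis j : Fin m → ℝ) ⬝ᵥ (hH.eigenvectorBasis j) = 1 := by
    simpa [dotProduct, sq] using hn
  simp only [star_trivial, dotProduct_sub, dotProduct_smul, h2, RCLike.re_to_real,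
    smul_eq_mul] at h
  linarith

/-- An eigenvector for the eigenvalue `1` has equal coordinates. -/
lemma exists_const_of_eigenvalue_one (hW : IsWeightMatrix G W) {j : Fin m}
    (hj : hW.posSemidef.isHermitian.eigenvalues j = 1) :
    ∃ c : ℝ, ∀ i, hW.posSemidef.isHermitian.eigenvectorBasis j i = c := by
  set hH := hW.posSemidef.isHermitian
  have h : (hH.eigenvectorBasis j : Fin m → ℝ) ∈ LinearMap.ker (Matrix.mulVecLin (1 - W)) := by
    rw [LinearMap.mem_ker, Matrix.mulVecLin_apply, Matrix.sub_mulVec, Matrix.one_mulVec,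
      hH.mulVec_eigenvectorBasis j, hj, one_smul, sub_self]
  rw [hW.null_eq, Submodule.mem_span_singleton] at h
  obtain ⟨c, hc⟩ := h
  exact ⟨c, fun i => by simp [← hc]⟩

/-- An eigenvector for an eigenvalue other than `1` has zero coordinate sum. -/
lemma sum_eq_zero_of_eigenvalue_ne_one (hW : IsWeightMatrix G W) {j : Fin m}
    (hj : hW.posSemidef.isHermitian.eigenvalues j ≠ 1) :
    ∑ i, hW.posSemidef.isHermitian.eigenvectorBasis j i = 0 := by
  set hH := hW.posSemidef.isHermitian
  -- Pairing with the one-column matrix of ones, which `W` fixes, yields `vᵀ1 = μ vᵀ1`.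
  have h := coef_mulRows hH (hH.mulVec_eigenvectorBasis j)
    (constRows m (EuclideanSpace.single (0 : Fin 1) (1 : ℝ)))
  have h1 : mulRows W (constRows m (EuclideanSpace.single (0 : Fin 1) (1 : ℝ)))
      = constRows m (EuclideanSpace.single (0 : Fin 1) (1 : ℝ)) := by
    ext1 i
    have := congrFun hW.mulVec_one i
    simp only [Matrix.mulVec, dotProduct, Pi.one_apply, mul_one] at this
    simp [mulRows, constRows, ← Finset.sum_smul, this]
  rw [h1, coef_constRows] at h
  have h2 := congrArg (fun u : Vec 1 => u 0) h
  simp only [PiLp.smul_apply, PiLp.single_apply, if_true, smul_eq_mul, mul_one] at h2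
  by_contra hne
  exact hj (mul_right_cancel₀ hne (by rw [← h2, one_mul]))

lemma eigenvalue_one_unique (hW : IsWeightMatrix G W) {j k : Fin m}
    (hj : hW.posSemidef.isHermitian.eigenvalues j = 1)
    (hk : hW.posSemidef.isHermitian.eigenvalues k = 1) : j = k := by
  obtain ⟨a, ha⟩ := hW.exists_const_of_eigenvalue_one hj
  obtain ⟨b, hb⟩ := hW.exists_const_of_eigenvalue_one hk
  set hH := hW.posSemidef.isHermitian
  have hm : (m : ℝ) ≠ 0 := by exact_mod_cast (j.pos).ne'
  have hjj : ‖hH.eigenvectorBasis j‖ ^ 2 = 1 := by simp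
  have hkk : ‖hH.eigenvectorBasis k‖ ^ 2 = 1 := by simp
  rw [EuclideanSpace.norm_sq_eq] at hjj hkk
  by_contra hne
  have hjk : inner ℝ (hH.eigenvectorBasis j) (hH.eigenvectorBasis k) = (0 : ℝ) :=
    hH.eigenvectorBasis.orthonormal.2 hne
  simp only [PiLp.inner_apply, ha, hb] at hjk
  simp only [ha] at hjj
  simp only [hb] at hkk
  simp [hm] at hjj hkk hjk
  obtain rfl | rfl := hjk <;> simp at hjj hkk

/-- Otherwise every eigenvector is orthogonal to the vector of ones, and Parseval makes its squared
norm `m` vanish. -/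
lemma exists_eigenvalue_one (hm : 0 < m) (hW : IsWeightMatrix G W) :
    ∃ j, hW.posSemidef.isHermitian.eigenvalues j = 1 := by
  by_contra! h
  have h1 := sum_norm_coef_sq hW.posSemidef.isHermitian.eigenvectorBasis
    (constRows m (EuclideanSpace.single (0 : Fin 1) (1 : ℝ)))
  simp only [coef_constRows, hW.sum_eq_zero_of_eigenvalue_ne_one (h _), zero_smul, norm_zero] at h1
  simp [frobSq, constRows] at h1
  exact hm.ne (by exact_mod_cast h1)

/-- All eigenvalues but the simple eigenvalue `1` are at most `λ₂`, and `0 ≤ λ₂ < 1`. -/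
lemma lambda2_spec (hm : 2 ≤ m) (hW : IsWeightMatrix G W) :
    0 ≤ lambda2 hm hW.posSemidef.isHermitian ∧ lambda2 hm hW.posSemidef.isHermitian < 1 ∧
      ∀ j, hW.posSemidef.isHermitian.eigenvalues j ≠ 1 →
        hW.posSemidef.isHermitian.eigenvalues j ≤ lambda2 hm hW.posSemidef.isHermitian := by
  obtain ⟨j₀, hj₀⟩ := hW.exists_eigenvalue_one (by omega)
  set hH := hW.posSemidef.isHermitian
  set e : Fin (Fintype.card (Fin m)) ≃ Fin m := Fintype.equivOfCardEq (Fintype.card_fin _) with he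
  have hev : ∀ k, hH.eigenvalues (e k) = hH.eigenvalues₀ k := fun k => by
    simp [Matrix.IsHermitian.eigenvalues, he]
  have hcard : 1 < Fintype.card (Fin m) := by rw [Fintype.card_fin]; omega
  set i0 : Fin (Fintype.card (Fin m)) := ⟨0, by omega⟩
  set i1 : Fin (Fintype.card (Fin m)) := ⟨1, hcard⟩
  have hlam : lambda2 hm hH = hH.eigenvalues₀ i1 := rfl
  have htop : hH.eigenvalues (e i0) = 1 := by
    refine le_antisymm (hW.eigenvalue_le_one _) ?_
    rw [← hj₀, hev, ← e.apply_symm_apply j₀, hev]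
    exact hH.eigenvalues₀_antitone (Fin.mk_le_of_le_val (Nat.zero_le _))
  refine ⟨?_, ?_, fun j hj => ?_⟩
  · rw [hlam, ← hev]
    exact hW.posSemidef.eigenvalues_nonneg _
  · rw [hlam, ← hev]
    refine lt_of_le_of_ne (hW.eigenvalue_le_one _) fun h => ?_
    have := e.injective (hW.eigenvalue_one_unique h htop)
    simp [i0, i1] at this
  · rw [hlam, ← e.apply_symm_apply j, hev]
    refine hH.eigenvalues₀_antitone ?_
    rw [Fin.le_def]
    by_contra hlt
    refine hj ?_
    rw [← htop, ← e.apply_symm_apply j]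
    congr 2
    ext
    simp only [i0, i1] at hlt ⊢
    omega

/-- `FastMix` contracts the deviations from the average. -/
lemma frobSq_dev_fastMix_le (hm : 2 ≤ m) (hW : IsWeightMatrix G W) {lam : ℝ}
    (hlam : lam = lambda2 hm hW.posSemidef.isHermitian) {K : ℕ}
    (hK : 15 / Real.sqrt (1 - lam) ≤ K) (x : Rows m d) :
    frobSq (dev (fastMix W (mixParam lam) x K)) ≤ 1 / 8192 * frobSq (dev x) := by
  obtain ⟨h0, h1, hle⟩ := hW.lambda2_spec hm
  rw [← hlam] at h0 h1 hle
  set hH := hW.posSemidef.isHermitian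
  rw [← sum_norm_coef_sq hH.eigenvectorBasis, ← sum_norm_coef_sq hH.eigenvectorBasis (dev x),
    Finset.mul_sum]
  refine Finset.sum_le_sum fun j _ => ?_
  by_cases hj : hH.eigenvalues j = 1
  · obtain ⟨c, hc⟩ := hW.exists_const_of_eigenvalue_one hj
    rw [coef_dev_of_const (by omega) hc, coef_dev_of_const (by omega) hc]
    simp
  · rw [coef_dev, coef_dev, hW.sum_eq_zero_of_eigenvalue_ne_one hj, zero_smul, zero_smul, sub_zero,
      sub_zero, coef_fastMix hH (hH.mulVec_eigenvectorBasis j), norm_smul, mul_pow, Real.norm_eq_abs,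
      sq_abs]
    gcongr
    exact mixPoly_contraction h0 h1 hK (hW.posSemidef.eigenvalues_nonneg j) (hle j hj)

end IsWeightMatrix

/-! ### Convex smooth functions -/

namespace IsConvexSmooth

variable {L : ℝ} {f : Vec d → ℝ}

/-- Cocoercivity of the gradient. -/
lemma norm_gradient_sub_sq_le (hf : IsConvexSmooth L f) (hL : 0 < L) (x y : Vec d) :
    ‖gradient f y - gradient f x‖ ^ 2 ≤
      2 * L * (f y - f x - inner ℝ (gradient f x) (y - x)) := by
  set v := gradient f y - gradient f x with hv
  -- The test point is a gradient step from `y` on `f - ⟨∇f x, ·⟩`, a convex function minimized at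
  -- `x`.
  have h1 := hf.lower x (y - (1 / L) • v)
  have h2 := hf.upper y (y - (1 / L) • v)
  have e1 : inner ℝ (gradient f x) (y - (1 / L) • v - x)
      = inner ℝ (gradient f x) (y - x) - 1 / L * inner ℝ (gradient f x) v := by
    rw [sub_right_comm, inner_sub_right, real_inner_smul_right]
  have e2 : inner ℝ (gradient f y) (y - (1 / L) • v - y) = -(1 / L * inner ℝ (gradient f y) v) := by
    rw [sub_sub_cancel_left, inner_neg_right, real_inner_smul_right]
  have e3 : ‖y - (y - (1 / L) • v)‖ ^ 2 = (1 / L) ^ 2 * ‖v‖ ^ 2 := by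
    rw [sub_sub_cancel, norm_smul, mul_pow, Real.norm_eq_abs, sq_abs]
  have e4 : inner ℝ (gradient f y) v - inner ℝ (gradient f x) v = ‖v‖ ^ 2 := by
    rw [← inner_sub_left, ← hv, real_inner_self_eq_norm_sq]
  rw [e1] at h1
  rw [e2, e3] at h2
  have h3 : 1 / L * ‖v‖ ^ 2 - L / 2 * ((1 / L) ^ 2 * ‖v‖ ^ 2) = ‖v‖ ^ 2 / (2 * L) := by
    field_simp
    ring
  have h4 : ‖v‖ ^ 2 / (2 * L) ≤ f y - f x - inner ℝ (gradient f x) (y - x) := by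
    rw [← h3]
    have := congrArg (fun t => 1 / L * t) e4
    simp only [mul_sub] at this
    linarith
  rw [div_le_iff₀ (by positivity)] at h4
  linarith

lemma norm_gradient_sub_sq_le_norm_sq (hf : IsConvexSmooth L f) (hL : 0 < L) (x y : Vec d) :
    ‖gradient f y - gradient f x‖ ^ 2 ≤ L ^ 2 * ‖y - x‖ ^ 2 := by
  have h1 := hf.norm_gradient_sub_sq_le hL x y
  have h2 := hf.upper x y
  rw [norm_sub_rev x y] at h2
  have h3 : 2 * L * (f y - f x - inner ℝ (gradient f x) (y - x))
      ≤ 2 * L * (L / 2 * ‖y - x‖ ^ 2) := by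
    gcongr
    linarith
  linarith

end IsConvexSmooth

lemma frobSq_gradRows_sub_le {L : ℝ} (hL : 0 < L) {f : Fin m → Vec d → ℝ}
    (hf : ∀ i, IsConvexSmooth L (f i)) (x y : Rows m d) :
    frobSq (gradRows f y - gradRows f x) ≤ L ^ 2 * frobSq (y - x) := by
  simp only [frobSq, Finset.mul_sum]
  exact Finset.sum_le_sum fun i _ => (hf i).norm_gradient_sub_sq_le_norm_sq hL _ _

/-! ### The proximal operator -/

/-- A lower bound for `g` on the unit ball around `x` extends, by convexity along rays from `x`, to
a bound decreasing at most linearly in the distance. The quadratic term dominates it outside a large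
ball, where the objective exceeds its value at `x`; inside, compactness gives a minimizer. -/
lemma exists_prox {γ : ℝ} (hγ : 0 < γ) {g : Vec d → ℝ} (hg : ConvexOn ℝ Set.univ g) (x : Vec d) :
    ∃ w, ∀ u, γ * g w + 1 / 2 * ‖w - x‖ ^ 2 ≤ γ * g u + 1 / 2 * ‖u - x‖ ^ 2 := by
  have hgc : Continuous g := by
    rw [← continuousOn_univ]
    exact hg.continuousOn isOpen_univ
  obtain ⟨w₀, -, hw₀⟩ := (isCompact_closedBall x 1).exists_isMinOn
    ⟨x, Metric.mem_closedBall_self zero_le_one⟩ hgc.continuousOn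
  have hball : ∀ u, ‖u - x‖ ≤ 1 → g w₀ ≤ g u := fun u hu =>
    hw₀ (by rwa [Metric.mem_closedBall, dist_eq_norm])
  have hcont : Continuous fun w => γ * g w + 1 / 2 * ‖w - x‖ ^ 2 := by fun_prop
  set R := max 1 (2 * γ * (g x - g w₀))
  have hR : 0 ≤ R := zero_le_one.trans (le_max_left _ _)
  obtain ⟨w, -, hw⟩ := (isCompact_closedBall x R).exists_isMinOn
    ⟨x, Metric.mem_closedBall_self hR⟩ hcont.continuousOn
  refine ⟨w, fun u => ?_⟩
  by_cases hu : ‖u - x‖ ≤ R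
  · exact hw (by rwa [Metric.mem_closedBall, dist_eq_norm])
  · refine le_trans (hw (Metric.mem_closedBall_self hR)) ?_
    push Not at hu
    have hr1 : 1 < ‖u - x‖ := (le_max_left _ _).trans_lt hu
    have hr2 : 2 * γ * (g x - g w₀) < ‖u - x‖ := (le_max_right _ _).trans_lt hu
    set r := ‖u - x‖
    have hr0 : 0 < r := by linarith
    have hmem : ‖((1 - 1 / r) • x + (1 / r) • u) - x‖ ≤ 1 := by
      rw [show ((1 - 1 / r) • x + (1 / r) • u) - x = (1 / r) • (u - x) by module, norm_smul,
        Real.norm_of_nonneg (by positivity), one_div_mul_cancel hr0.ne']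
    have h1 := (hball _ hmem).trans (hg.2 (Set.mem_univ x) (Set.mem_univ u)
      (sub_nonneg.2 (by rw [div_le_one hr0]; exact hr1.le)) (by positivity) (by ring))
    simp only [smul_eq_mul] at h1
    have h2 : r * g w₀ ≤ (r - 1) * g x + g u := by
      have := mul_le_mul_of_nonneg_left h1 hr0.le
      field_simp at this
      linarith
    have h3 : r * (2 * γ * (g x - g w₀)) ≤ r * r := by gcongr
    have h4 := mul_le_mul_of_nonneg_left h2 hγ.le
    simp only [sub_self, norm_zero]
    nlinarith

lemma prox_spec {γ : ℝ} (hγ : 0 < γ) {g : Vec d → ℝ} (hg : ConvexOn ℝ Set.univ g) (x u : Vec d) :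
    γ * g (prox γ g x) + 1 / 2 * ‖prox γ g x - x‖ ^ 2 ≤ γ * g u + 1 / 2 * ‖u - x‖ ^ 2 :=
  Classical.epsilon_spec (exists_prox hγ hg x) u

lemma nonneg_of_forall_add_mul_nonneg {a b : ℝ} (h : ∀ θ : ℝ, 0 < θ → θ ≤ 1 → 0 ≤ a + θ * b) :
    0 ≤ a := by
  have hc : Filter.Tendsto (fun θ : ℝ => a + θ * b) (nhdsWithin 0 (Set.Ioi 0)) (nhds (a + 0 * b)) :=
    (Continuous.tendsto (by fun_prop) 0).mono_left nhdsWithin_le_nhds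
  rw [zero_mul, add_zero] at hc
  refine ge_of_tendsto hc ?_
  filter_upwards [Ioc_mem_nhdsGT (zero_lt_one (α := ℝ))] with θ hθ using h θ hθ.1 hθ.2

/-- The variational inequality that characterises the proximal point. -/
lemma prox_variational {γ : ℝ} (hγ : 0 < γ) {g : Vec d → ℝ} (hg : ConvexOn ℝ Set.univ g)
    (x u : Vec d) :
    γ * (g (prox γ g x) - g u) ≤ inner ℝ (x - prox γ g x) (prox γ g x - u) := by
  set p := prox γ g x
  suffices h : 0 ≤ γ * (g u - g p) + inner ℝ (p - x) (u - p) by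
    have e : inner ℝ (x - p) (p - u) = (inner ℝ (p - x) (u - p) : ℝ) := by
      rw [← neg_sub p x, ← neg_sub u p, inner_neg_neg]
    rw [e]
    linarith
  -- Minimality of `p` is tested along the segment to `u`, divided by `θ`, and passed to the limit
  -- `θ → 0`.
  refine nonneg_of_forall_add_mul_nonneg (b := 1 / 2 * ‖u - p‖ ^ 2) fun θ h0 h1 => ?_
  have hs := prox_spec hγ hg x ((1 - θ) • p + θ • u)
  have hc := hg.2 (Set.mem_univ p) (Set.mem_univ u) (sub_nonneg.2 h1) h0.le (by ring)
  simp only [smul_eq_mul] at hc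
  have hn : ‖(1 - θ) • p + θ • u - x‖ ^ 2
      = ‖p - x‖ ^ 2 + 2 * (θ * inner ℝ (p - x) (u - p)) + θ ^ 2 * ‖u - p‖ ^ 2 := by
    rw [show (1 - θ) • p + θ • u - x = (p - x) + θ • (u - p) by module, norm_add_sq_real,
      real_inner_smul_right, norm_smul, mul_pow, Real.norm_eq_abs, sq_abs]
  rw [hn] at hs
  have hc' := mul_le_mul_of_nonneg_left hc hγ.le
  refine nonneg_of_mul_nonneg_right ?_ h0
  change 0 ≤ θ * (γ * (g u - g p) + inner ℝ (p - x) (u - p) + θ * (1 / 2 * ‖u - p‖ ^ 2))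
  nlinarith

/-! ### One step of the algorithm -/

lemma mul_objective (hm : 0 < m) (f : Fin m → Vec d → ℝ) (g : Vec d → ℝ) (x : Vec d) :
    m * objective f g x = ∑ i, f i x + m * g x := by
  have : (m : ℝ) ≠ 0 := by positivity
  rw [objective]
  field_simp

lemma mul_map_avg_le (hm : 0 < m) {g : Vec d → ℝ} (hg : ConvexOn ℝ Set.univ g) (p : Rows m d) :
    m * g (avg p) ≤ ∑ i, g (p i) := by
  have hm' : (m : ℝ) ≠ 0 := by positivity
  have h := hg.map_sum_le (t := Finset.univ) (w := fun _ : Fin m => 1 / (m : ℝ)) (p := p)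
    (fun _ _ => by positivity) (by simp [hm']) (fun _ _ => Set.mem_univ _)
  rw [← Finset.smul_sum] at h
  simp only [smul_eq_mul, ← Finset.mul_sum] at h
  calc m * g (avg p) ≤ m * (1 / (m : ℝ) * ∑ i, g (p i)) := by gcongr; exact h
    _ = ∑ i, g (p i) := by field_simp

lemma sum_inner_eq (hm : 0 < m) (s p : Rows m d) (u : Vec d) :
    ∑ i, inner ℝ (s i) (p i - u)
      = m * inner ℝ (avg s) (avg p - u) + ∑ i, (inner ℝ (dev s i) (dev p i) : ℝ) := by
  have h : ∀ i, inner ℝ (s i) (p i - u) = inner ℝ (avg s) (avg p - u)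
      + inner ℝ (avg s) (dev p i) + inner ℝ (dev s i) (avg p - u)
      + (inner ℝ (dev s i) (dev p i) : ℝ) := by
    intro i
    rw [show s i = avg s + dev s i by simp [dev], show p i - u = (avg p - u) + dev p i by
      simp [dev], inner_add_left, inner_add_right, inner_add_right]
    ring
  simp only [h, Finset.sum_add_distrib, ← sum_inner, ← inner_sum, sum_dev hm]
  simp [← Nat.cast_smul_eq_nsmul ℝ, real_inner_smul_left]

lemma neg_sum_inner_le {γ : ℝ} (hγ : 0 < γ) (s p : Rows m d) :
    -∑ i, (inner ℝ (s i) (p i) : ℝ) ≤ γ * frobSq s + 1 / (4 * γ) * frobSq p := by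
  simp only [frobSq, Finset.mul_sum, ← Finset.sum_add_distrib, ← Finset.sum_neg_distrib]
  refine Finset.sum_le_sum fun i _ => ?_
  have h1 := neg_le_of_abs_le (abs_real_inner_le_norm (s i) (p i))
  have h2 : 0 ≤ γ * (‖s i‖ - 1 / (2 * γ) * ‖p i‖) ^ 2 := by positivity
  have h3 : γ * (‖s i‖ - 1 / (2 * γ) * ‖p i‖) ^ 2
      = γ * ‖s i‖ ^ 2 + 1 / (4 * γ) * ‖p i‖ ^ 2 - ‖s i‖ * ‖p i‖ := by
    field_simp
    ring
  linarith

/-- Sums the proximal variational inequalities over the agents. Splitting `s` and `p` into average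
and deviation leaves the averaged pairing and a cross term of deviations, treated by Young's
inequality. Its share `1/4` of the deviation of `p` is half of what the term `-1/2 * frobSq (p -
constRows m u)` can absorb. -/
lemma sum_prox_le (hm : 0 < m) {γ : ℝ} (hγ : 0 < γ) {g : Vec d → ℝ}
    (hg : ConvexOn ℝ Set.univ g) (z s : Rows m d) (u : Vec d) {p : Rows m d}
    (hp : p = proxRows γ g (z - γ • s)) :
    γ * (∑ i, g (p i) - m * g u + m * inner ℝ (avg s) (avg p - u)) ≤
      1 / 2 * (frobSq (z - constRows m u) - frobSq (p - constRows m u)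
        - m * ‖avg p - avg z‖ ^ 2) + γ ^ 2 * frobSq (dev s) + 1 / 4 * frobSq (dev p) := by
  have h1 : ∀ i, γ * (g (p i) - g u) ≤ 1 / 2 * (‖z i - u‖ ^ 2 - ‖p i - u‖ ^ 2 - ‖p i - z i‖ ^ 2)
      - γ * inner ℝ (s i) (p i - u) := by
    intro i
    have h := prox_variational hγ hg ((z - γ • s) i) u
    rw [show prox γ g ((z - γ • s) i) = p i by rw [hp]; rfl] at h
    refine h.trans_eq ?_
    have e1 : (z - γ • s) i - p i = ((z i - u) - (p i - u)) - γ • s i := by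
      simp only [Pi.sub_apply, Pi.smul_apply]; abel
    have e2 : p i - z i = (p i - u) - (z i - u) := by abel
    rw [e1, e2, inner_sub_left, inner_sub_left, real_inner_smul_left, norm_sub_sq_real (p i - u),
      real_inner_self_eq_norm_sq, real_inner_comm (p i - u) (z i - u)]
    ring
  have h2 := Finset.sum_le_sum fun i (_ : i ∈ Finset.univ) => h1 i
  simp only [← Finset.mul_sum, Finset.sum_sub_distrib, sum_inner_eq hm, Finset.sum_const,
    Finset.card_univ, Fintype.card_fin, nsmul_eq_mul] at h2
  have h3 := mul_le_mul_of_nonneg_left (neg_sum_inner_le hγ (dev s) (dev p)) hγ.le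
  have h4 := mul_norm_avg_sq_le hm (p - z)
  rw [avg_sub] at h4
  have h5 : γ * (1 / (4 * γ) * frobSq (dev p)) = 1 / 4 * frobSq (dev p) := by field_simp
  simp only [frobSq, Pi.sub_apply, constRows] at h2 h3 h4 h5 ⊢
  linarith

/-- The progress of the averaged iterates in one step. -/
lemma objective_step_le (hm : 0 < m) {L : ℝ} (hL : 0 < L) {f : Fin m → Vec d → ℝ}
    (hf : ∀ i, IsConvexSmooth L (f i)) {g : Vec d → ℝ} (hg : ConvexOn ℝ Set.univ g)
    {γ τ : ℝ} (hγ : 0 < γ) (hτ0 : 0 ≤ τ) (hτ1 : τ ≤ 1) (u : Vec d)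
    {x' y z s p : Rows m d} {y' : Vec d} (hx' : x' = τ • z + (1 - τ) • y)
    (hs : avg s = avg (gradRows f x')) (hp : p = proxRows γ g (z - γ • s))
    (hy' : y' = τ • avg p + (1 - τ) • avg y) :
    m * (objective f g y' - objective f g u) ≤
      (1 - τ) * (m * (objective f g (avg y) - objective f g u))
      + τ / γ * (1 / 2 * (frobSq (z - constRows m u) - frobSq (p - constRows m u)
        - m * ‖avg p - avg z‖ ^ 2) + γ ^ 2 * frobSq (dev s) + 1 / 4 * frobSq (dev p))
      + L / 2 * (τ ^ 2 * (m * ‖avg p - avg z‖ ^ 2) + frobSq (dev x'))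
      - (1 - τ) / (2 * L) * frobSq (gradRows f x' - gradRows f (constRows m (avg y))) := by
  have hprox := mul_le_mul_of_nonneg_left (sum_prox_le hm hγ hg z s u hp)
    (div_nonneg hτ0 hγ.le : 0 ≤ τ / γ)
  rw [← mul_assoc, div_mul_cancel₀ _ hγ.ne'] at hprox
  have hJ := mul_le_mul_of_nonneg_left (mul_map_avg_le hm hg p) hτ0
  have hgy := hg.2 (Set.mem_univ (avg p)) (Set.mem_univ (avg y)) hτ0 (sub_nonneg.2 hτ1) (by ring)
  rw [← hy'] at hgy
  simp only [smul_eq_mul] at hgy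
  have hgy' := mul_le_mul_of_nonneg_left hgy (Nat.cast_nonneg (α := ℝ) m)
  have hup : ∑ i, f i y' ≤ ∑ i, (f i (x' i) + inner ℝ (gradRows f x' i) (y' - x' i))
      + L / 2 * frobSq (x' - constRows m y') := by
    rw [frobSq, Finset.mul_sum, ← Finset.sum_add_distrib]
    exact Finset.sum_le_sum fun i _ => (hf i).upper (x' i) y'
  have hdist : frobSq (x' - constRows m y')
      = τ ^ 2 * (m * ‖avg p - avg z‖ ^ 2) + frobSq (dev x') := by
    rw [frobSq_sub_constRows hm, hx', avg_add, avg_smul, avg_smul, hy',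
      show τ • avg z + (1 - τ) • avg y - (τ • avg p + (1 - τ) • avg y)
        = (-τ) • (avg p - avg z) by module, norm_smul, mul_pow, Real.norm_eq_abs, sq_abs]
    ring
  have hlow_u : ∑ i, (f i (x' i) + inner ℝ (gradRows f x' i) (u - x' i)) ≤ ∑ i, f i u :=
    Finset.sum_le_sum fun i _ => (hf i).lower (x' i) u
  -- The cocoercive gain is retained here; it later pays for the gradient variation in the tracking
  -- error.
  have hlow_y : ∑ i, (f i (x' i) + inner ℝ (gradRows f x' i) (avg y - x' i))
      + 1 / (2 * L) * frobSq (gradRows f x' - gradRows f (constRows m (avg y)))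
      ≤ ∑ i, f i (avg y) := by
    rw [frobSq, Finset.mul_sum, ← Finset.sum_add_distrib]
    refine Finset.sum_le_sum fun i _ => ?_
    have h := (hf i).norm_gradient_sub_sq_le hL (x' i) (avg y)
    rw [norm_sub_rev] at h
    have h' : 1 / (2 * L) * ‖gradient (f i) (x' i) - gradient (f i) (avg y)‖ ^ 2
        ≤ f i (avg y) - f i (x' i) - inner ℝ (gradient (f i) (x' i)) (avg y - x' i) := by
      rw [one_div, inv_mul_le_iff₀ (by positivity)]
      exact h
    simp only [gradRows, constRows, Pi.sub_apply]
    linarith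
  -- The direction to `y'` splits into those to `avg y`, to `u`, and the common vector `avg p - u`.
  -- The last sees only the average gradient, which is `avg s`, and so matches the pairing in
  -- `sum_prox_le`.
  have hlin : ∑ i, (f i (x' i) + inner ℝ (gradRows f x' i) (y' - x' i))
      = (1 - τ) * ∑ i, (f i (x' i) + inner ℝ (gradRows f x' i) (avg y - x' i))
        + τ * ∑ i, (f i (x' i) + inner ℝ (gradRows f x' i) (u - x' i))
        + τ * (m * inner ℝ (avg s) (avg p - u)) := by
    rw [hs, ← real_inner_smul_left (avg (gradRows f x')), ← sum_rows hm, sum_inner,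
      Finset.mul_sum, Finset.mul_sum, Finset.mul_sum, ← Finset.sum_add_distrib,
      ← Finset.sum_add_distrib]
    refine Finset.sum_congr rfl fun i _ => ?_
    rw [show y' - x' i = (1 - τ) • (avg y - x' i) + τ • (u - x' i) + τ • (avg p - u) by
      rw [hy']; module, inner_add_right, inner_add_right, real_inner_smul_right,
      real_inner_smul_right, real_inner_smul_right]
    ring
  have hlow_u' := mul_le_mul_of_nonneg_left hlow_u hτ0
  have hlow_y' := mul_le_mul_of_nonneg_left hlow_y (sub_nonneg.2 hτ1)
  rw [hlin, hdist] at hup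
  rw [mul_sub, mul_sub (m : ℝ) (objective f g (avg y)), mul_objective hm, mul_objective hm,
    mul_objective hm]
  rw [show (1 - τ) / (2 * L) = (1 - τ) * (1 / (2 * L)) by ring]
  linarith

lemma frobSq_dev_comb_le (τ : ℝ) (z y : Rows m d) :
    frobSq (dev (τ • z + (1 - τ) • y)) ≤
      2 * (τ ^ 2 * frobSq (dev z)) + 2 * ((1 - τ) ^ 2 * frobSq (dev y)) := by
  rw [dev_add, dev_smul, dev_smul, ← frobSq_smul, ← frobSq_smul]
  exact frobSq_add_le _ _

/-- An averaging operator: it keeps the average of the rows and contracts their deviations. -/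
structure IsMixing (mix : Rows m d → Rows m d) : Prop where
  avg_eq : ∀ x, avg (mix x) = avg x
  dev_le : ∀ x, frobSq (dev (mix x)) ≤ 1 / 8192 * frobSq (dev x)

section Step

variable {mix : Rows m d → Rows m d} {f : Fin m → Vec d → ℝ} {g : Vec d → ℝ}

/-- The proximal point computed in one step, before it is averaged. -/
def proxPoint (mix : Rows m d → Rows m d) (f : Fin m → Vec d → ℝ) (g : Vec d → ℝ) (γ τ : ℝ)
    (S : State m d) : Rows m d :=
  proxRows γ g (S.z - γ • (step mix f g γ τ S).s)

namespace IsMixing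

lemma avg_step_z (hmix : IsMixing mix) (γ τ : ℝ) (S : State m d) :
    avg (step mix f g γ τ S).z = avg (proxPoint mix f g γ τ S) :=
  hmix.avg_eq _

lemma avg_step_y (hmix : IsMixing mix) (γ τ : ℝ) (S : State m d) :
    avg (step mix f g γ τ S).y
      = τ • avg (proxPoint mix f g γ τ S) + (1 - τ) • avg S.y := by
  rw [← hmix.avg_step_z, ← avg_smul, ← avg_smul, ← avg_add]
  exact hmix.avg_eq _

/-- Gradient tracking: the average of `s` is the average gradient. -/
lemma avg_step_s (hmix : IsMixing mix) (γ τ : ℝ) {S : State m d}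
    (hS : avg S.s = avg (gradRows f S.x)) :
    avg (step mix f g γ τ S).s = avg (gradRows f (step mix f g γ τ S).x) := by
  refine (hmix.avg_eq _).trans ?_
  rw [avg_sub, avg_add, hS, add_sub_cancel_left]
  rfl

lemma dev_step_z_le (hmix : IsMixing mix) (γ τ : ℝ) (S : State m d) :
    frobSq (dev (step mix f g γ τ S).z) ≤ 1 / 8192 * frobSq (dev (proxPoint mix f g γ τ S)) :=
  hmix.dev_le _

lemma dev_step_y_le (hmix : IsMixing mix) (γ τ : ℝ) (S : State m d) :
    frobSq (dev (step mix f g γ τ S).y) ≤ 1 / 8192 *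
      (2 * (τ ^ 2 * frobSq (dev (step mix f g γ τ S).z))
        + 2 * ((1 - τ) ^ 2 * frobSq (dev S.y))) := by
  refine (hmix.dev_le _).trans ?_
  gcongr
  exact frobSq_dev_comb_le _ _ _

lemma frobSq_const_avg_sub_step_x (hm : 0 < m) (hmix : IsMixing mix) (γ τ : ℝ) (S : State m d) :
    frobSq (constRows m (avg (step mix f g γ τ S).y) - (step mix f g γ τ S).x)
      = τ ^ 2 * (m * ‖avg (step mix f g γ τ S).z - avg S.z‖ ^ 2)
        + frobSq (dev (step mix f g γ τ S).x) := by
  rw [← neg_sub, ← neg_one_smul ℝ, frobSq_smul, frobSq_sub_constRows hm, hmix.avg_step_y,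
    ← hmix.avg_step_z,
    show avg (step mix f g γ τ S).x = τ • avg S.z + (1 - τ) • avg S.y by
      rw [← avg_smul, ← avg_smul, ← avg_add]; rfl,
    show τ • avg S.z + (1 - τ) • avg S.y
        - (τ • avg (step mix f g γ τ S).z + (1 - τ) • avg S.y)
        = (-τ) • (avg (step mix f g γ τ S).z - avg S.z) by module,
    norm_smul, mul_pow, Real.norm_eq_abs, sq_abs]
  ring

/-- The gradient increment is split at the average of `y`. One half is exactly the term that
`lyapunov_step_le` makes negative at the next step; the other is controlled by Lipschitz continuity
through the movement of the average of `z` and the deviation of `x`. -/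
lemma dev_step_step_s_le (hm : 0 < m) (hmix : IsMixing mix) {L : ℝ} (hL : 0 < L)
    (hf : ∀ i, IsConvexSmooth L (f i)) (γ τ γ' τ' : ℝ) (S S' : State m d)
    (hS' : S' = step mix f g γ τ S) :
    frobSq (dev (step mix f g γ' τ' S').s) ≤ 1 / 8192 *
      (4 * frobSq (dev S'.s)
        + 4 * frobSq (gradRows f (step mix f g γ' τ' S').x - gradRows f (constRows m (avg S'.y)))
        + 2 * (L ^ 2 * (τ ^ 2 * (m * ‖avg S'.z - avg S.z‖ ^ 2) + frobSq (dev S'.x)))) := by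
  refine (hmix.dev_le _).trans ?_
  gcongr
  set x'' := (step mix f g γ' τ' S').x
  have h1 := frobSq_gradRows_sub_le hL hf S'.x (constRows m (avg S'.y))
  have h2 : frobSq (constRows m (avg S'.y) - S'.x)
      = τ ^ 2 * (m * ‖avg S'.z - avg S.z‖ ^ 2) + frobSq (dev S'.x) := by
    rw [hS']; exact hmix.frobSq_const_avg_sub_step_x hm γ τ S
  rw [h2] at h1
  have h3 := frobSq_add_add_le (dev S'.s)
    (dev (gradRows f x'' - gradRows f (constRows m (avg S'.y))))
    (dev (gradRows f (constRows m (avg S'.y)) - gradRows f S'.x))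
  rw [← dev_add, ← dev_add, show S'.s + (gradRows f x'' - gradRows f (constRows m (avg S'.y)))
    + (gradRows f (constRows m (avg S'.y)) - gradRows f S'.x)
    = S'.s + gradRows f x'' - gradRows f S'.x by abel] at h3
  have h4 := frobSq_dev_le hm (gradRows f x'' - gradRows f (constRows m (avg S'.y)))
  have h5 := frobSq_dev_le hm (gradRows f (constRows m (avg S'.y)) - gradRows f S'.x)
  change frobSq (dev (S'.s + gradRows f x'' - gradRows f S'.x)) ≤ _
  linarith

/-- The decrease of the Lyapunov function in one step with `τ = 2 / w`, `γ = w / (400 L)`. -/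
lemma lyapunov_step_le (hm : 0 < m) (hmix : IsMixing mix) {L : ℝ} (hL : 0 < L)
    (hf : ∀ i, IsConvexSmooth L (f i)) (hg : ConvexOn ℝ Set.univ g) {w γ τ : ℝ} (hw : 5 ≤ w)
    (hγ : γ = w / (400 * L)) (hτ : τ = 2 / w) (u : Vec d) {S S' : State m d}
    (hS : avg S.s = avg (gradRows f S.x)) (hS' : S' = step mix f g γ τ S) :
    w ^ 2 / 4 * (m * (objective f g (avg S'.y) - objective f g u))
        + 100 * L * frobSq (S'.z - constRows m u) ≤
      w * (w - 2) / 4 * (m * (objective f g (avg S.y) - objective f g u))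
        + 100 * L * frobSq (S.z - constRows m u)
        + L * (200 * (γ ^ 2 * frobSq (dev S'.s)) + 1 / 2 * (frobSq (dev S'.x) / τ ^ 2)
          - 49 * frobSq (dev (proxPoint mix f g γ τ S)) - 99 * (m * ‖avg S'.z - avg S.z‖ ^ 2)
          - 12000 * (γ ^ 2 *
            frobSq (gradRows f S'.x - gradRows f (constRows m (avg S.y))))) := by
  have hw0 : 0 < w := by linarith
  have hγ0 : 0 < γ := by rw [hγ]; positivity
  have hτ0 : 0 < τ := by rw [hτ]; positivity
  have hτ1 : τ ≤ 1 := by rw [hτ, div_le_one hw0]; linarith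
  subst hS'
  have h := objective_step_le (y' := avg (step mix f g γ τ S).y) hm hL hf hg hγ0 hτ0.le hτ1 u
    (x' := (step mix f g γ τ S).x) rfl (hmix.avg_step_s γ τ hS)
    (p := proxPoint mix f g γ τ S) rfl (hmix.avg_step_y γ τ S)
  have hz := hmix.dev_step_z_le (f := f) (g := g) γ τ S
  rw [← hmix.avg_step_z] at h
  rw [frobSq_sub_constRows hm (step mix f g γ τ S).z]
  rw [frobSq_sub_constRows hm (proxPoint mix f g γ τ S), ← hmix.avg_step_z] at h
  set S' := step mix f g γ τ S
  set P := frobSq (dev (proxPoint mix f g γ τ S))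
  set Q := frobSq (gradRows f S'.x - gradRows f (constRows m (avg S.y)))
  set Δ := (m : ℝ) * ‖avg S'.z - avg S.z‖ ^ 2
  set N := (m : ℝ) * ‖avg S'.z - u‖ ^ 2
  have hP : 0 ≤ P := frobSq_nonneg _
  have hQ : 0 ≤ Q := frobSq_nonneg _
  have hΔ : 0 ≤ Δ := by positivity
  have h' := mul_le_mul_of_nonneg_left h (by positivity : 0 ≤ w ^ 2 / 4)
  have e1 : w ^ 2 / 4 * (τ / γ) = 200 * L := by
    rw [hτ, hγ]; field_simp; norm_num
  have e2 : w ^ 2 / 4 * (1 - τ) = w * (w - 2) / 4 := by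
    rw [hτ]; field_simp
  have e3 : w ^ 2 / 4 * τ ^ 2 = 1 := by
    rw [hτ]; field_simp; norm_num
  have e4 : frobSq (dev S'.x) / τ ^ 2 = w ^ 2 / 4 * frobSq (dev S'.x) := by
    rw [hτ]; field_simp; norm_num
  -- The constant `12000` is the largest possible for `w ≥ 5`, with equality at `w = 5`.
  have e5 : L * (12000 * (γ ^ 2 * Q)) ≤ w * (w - 2) / 4 * (1 / (2 * L) * Q) := by
    have : w * (w - 2) / 4 * (1 / (2 * L) * Q) - L * (12000 * (γ ^ 2 * Q))
        = w * Q * (w - 5) / (20 * L) := by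
      rw [hγ]; field_simp; ring
    have h0 : 0 ≤ w * Q * (w - 5) / (20 * L) :=
      div_nonneg (mul_nonneg (by positivity) (by linarith)) (by positivity)
    linarith
  have e6 : 100 * L * frobSq (dev S'.z) ≤ 100 * L * (1 / 8192 * P) := by gcongr
  have e7 : 0 ≤ L * P := by positivity
  have e8 : 0 ≤ L * Δ := by positivity
  rw [e4]
  have e9 : ∀ a b c e : ℝ, w ^ 2 / 4 * ((1 - τ) * a + τ / γ * b + L / 2 * (τ ^ 2 * Δ + c)
      - (1 - τ) / (2 * L) * e) = (w ^ 2 / 4 * (1 - τ)) * a + (w ^ 2 / 4 * (τ / γ)) * b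
      + L / 2 * ((w ^ 2 / 4 * τ ^ 2) * Δ + w ^ 2 / 4 * c)
      - (w ^ 2 / 4 * (1 - τ)) * (1 / (2 * L) * e) := by intros; ring
  rw [e9, e1, e2, e3] at h'
  linarith

end IsMixing

end Step

/-! ### Absorption of the consensus errors and summation over time -/

/-- The recursion of the consensus errors keeps their total effect bounded by the first one. -/
lemma consensus_error_bound {L B : ℝ} (hL : 0 < L) {Φ σ X Y Z P D Q : ℕ → ℝ}
    (hσ : ∀ n, 0 ≤ σ n) (hX : ∀ n, 0 ≤ X n) (hY : ∀ n, 0 ≤ Y n)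
    (hP : ∀ n, 0 ≤ P n) (hD : ∀ n, 0 ≤ D n) (hQ : ∀ n, 0 ≤ Q n)
    (hY0 : Y 0 = 0) (hZ0 : Z 0 = 0)
    (hXle : ∀ n, X n ≤ 2 * Z n + 2 * Y n) (hZle : ∀ n, Z (n + 1) ≤ 1 / 8192 * P n)
    (hYle : ∀ n, Y (n + 1) ≤ 3 / 8192 * (Z (n + 1) + Y n))
    (hσle : ∀ n, σ (n + 1) ≤ 6 / 8192 * (σ n + Q (n + 1) + (D n + X n) / 40000))
    (hinit : Φ 1 ≤ B + L * (200 * σ 0 + 1 / 2 * X 0 - 49 * P 0 - 99 * D 0 - 12000 * Q 0))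
    (hstep : ∀ n, Φ (n + 2) ≤ Φ (n + 1) + L * (200 * σ (n + 1) + 1 / 2 * X (n + 1)
      - 49 * P (n + 1) - 99 * D (n + 1) - 12000 * Q (n + 1))) (n : ℕ) :
    Φ (n + 1) ≤ B + L * (300 * σ 0) := by
  -- The induction carries part of the negative terms as a reserve. At each step this reserve pays
  -- for the new errors, whose recursions carry the factor `1 / 8192`, and is then rebuilt from the
  -- new negative terms.
  have key : ∀ n, Φ (n + 1) + L * (σ n + X n + 50 * D n + 10 * P n + 10 * Y (n + 1))
      ≤ B + L * (300 * σ 0) := by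
    intro n
    induction n with
    | zero =>
      have h : 200 * σ 0 + 1 / 2 * X 0 - 49 * P 0 - 99 * D 0 - 12000 * Q 0
          + (σ 0 + X 0 + 50 * D 0 + 10 * P 0 + 10 * Y (0 + 1)) ≤ 300 * σ 0 := by
        linarith [hXle 0, hZle 0, hYle 0, hσ 0, hP 0, hD 0, hQ 0]
      have := mul_le_mul_of_nonneg_left h hL.le
      rw [zero_add] at *
      linarith
    | succ n ih =>
      have h : 200 * σ (n + 1) + 1 / 2 * X (n + 1) - 49 * P (n + 1) - 99 * D (n + 1)
          - 12000 * Q (n + 1)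
          + (σ (n + 1) + X (n + 1) + 50 * D (n + 1) + 10 * P (n + 1) + 10 * Y (n + 1 + 1))
          ≤ σ n + X n + 50 * D n + 10 * P n + 10 * Y (n + 1) := by
        linarith [hXle (n + 1), hZle n, hZle (n + 1), hYle (n + 1), hσle n, hσ n, hX n, hP n,
          hD n, hP (n + 1), hD (n + 1), hQ (n + 1), hY (n + 1)]
      have := mul_le_mul_of_nonneg_left h hL.le
      have := hstep n
      linarith
  have hpos : 0 ≤ L * (σ n + X n + 50 * D n + 10 * P n + 10 * Y (n + 1)) := by
    have := hσ n; have := hX n; have := hD n; have := hP n; have := hY (n + 1)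
    positivity
  linarith [key n]

/-- The convergence rate for an arbitrary averaging operator; the state `A n` is that at time
`n + 1`. -/
lemma accelerated_rate (hm : 0 < m) {mix : Rows m d → Rows m d} (hmix : IsMixing mix)
    {L : ℝ} (hL : 0 < L) {f : Fin m → Vec d → ℝ} (hf : ∀ i, IsConvexSmooth L (f i))
    {g : Vec d → ℝ} (hg : ConvexOn ℝ Set.univ g) {γ τ : ℕ → ℝ}
    (hγ : ∀ n, γ n = ((n : ℝ) + 5) / (400 * L)) (hτ : ∀ n, τ n = 2 / ((n : ℝ) + 5))
    {x₁ u : Vec d} (hu : ∀ x, objective f g u ≤ objective f g x) {A : ℕ → State m d}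
    (hA0 : A 0 = initState f x₁) (hA : ∀ n, A (n + 1) = step mix f g (γ n) (τ n) (A n)) (n : ℕ) :
    ((n : ℝ) + 5) ^ 2 / 4 * (m * (objective f g (avg (A (n + 1)).y) - objective f g u)) ≤
      15 / 4 * (m * (objective f g (avg (A 0).y) - objective f g u))
        + 100 * L * frobSq ((A 0).z - constRows m u)
        + 1 / L * (1 / 160000 * frobSq (dev (A 0).s)) := by
  have hw : ∀ n : ℕ, 0 < (n : ℝ) + 5 := fun n => by positivity
  have hτpos : ∀ n, 0 < τ n := fun n => by rw [hτ]; exact div_pos two_pos (hw n)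
  have hτ1 : ∀ n, (1 - τ n) ^ 2 ≤ 1 := fun n => by
    have : τ n ≤ 1 := by
      rw [hτ, div_le_one (hw n)]
      linarith [Nat.cast_nonneg (α := ℝ) n]
    exact pow_le_one₀ (by linarith) (by linarith [hτpos n])
  have hgap : ∀ x, 0 ≤ m * (objective f g x - objective f g u) := fun x =>
    mul_nonneg (Nat.cast_nonneg _) (sub_nonneg.2 (hu x))
  have hratio : ∀ n, γ (n + 1) ^ 2 ≤ 36 / 25 * γ n ^ 2 := fun n => by
    have h1 : γ (n + 1) ≤ 6 / 5 * γ n := by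
      rw [hγ, hγ, mul_div_assoc']
      gcongr
      push_cast
      linarith [Nat.cast_nonneg (α := ℝ) n]
    have h2 : 0 ≤ γ (n + 1) := by rw [hγ]; positivity
    calc γ (n + 1) ^ 2 ≤ (6 / 5 * γ n) ^ 2 := by gcongr
      _ = 36 / 25 * γ n ^ 2 := by ring
  have hγτ : ∀ n, γ n = 1 / (200 * L * τ n) := fun n => by
    rw [hγ, hτ]
    have := hw n
    field_simp
    norm_num
  have hτratio : ∀ n, τ n ^ 2 / τ (n + 1) ^ 2 ≤ 36 / 25 := fun n => by
    have h := hratio n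
    rw [hγτ, hγτ] at h
    have h1 := hτpos n
    have h2 := hτpos (n + 1)
    rw [div_le_iff₀ (by positivity)]
    field_simp at h
    linarith
  have htrack : ∀ n, avg (A n).s = avg (gradRows f (A n).x) := by
    intro n
    induction n with
    | zero => rw [hA0]; rfl
    | succ n ih => rw [hA]; exact hmix.avg_step_s _ _ ih
  -- As `z` and `y` start equal, the first gradient increment vanishes and the first tracking update
  -- only mixes the initial `s`.
  have hx1 : (A 1).x = (A 0).x := by
    rw [hA, hA0]
    change τ 0 • constRows m x₁ + (1 - τ 0) • constRows m x₁ = constRows m x₁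
    rw [← add_smul, add_sub_cancel, one_smul]
  have hzero : frobSq (0 : Rows m d) = 0 := by simp [frobSq]
  have hdevz : frobSq (dev (A 0).z) = 0 := by
    rw [hA0, ← hzero, ← dev_constRows hm x₁]; rfl
  have hdevy : frobSq (dev (A 0).y) = 0 := by
    rw [hA0, ← hzero, ← dev_constRows hm x₁]; rfl
  have hσ0 : γ 0 ^ 2 * frobSq (dev (A 1).s)
      ≤ 25 / (160000 * L ^ 2) * (1 / 8192 * frobSq (dev (A 0).s)) := by
    have h1 : (A 1).s = mix ((A 0).s + gradRows f (A 1).x - gradRows f (A 0).x) := by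
      rw [hA]; rfl
    rw [hx1, add_sub_cancel_right] at h1
    have h2 : γ 0 ^ 2 = 25 / (160000 * L ^ 2) := by
      rw [hγ]; push_cast; field_simp; norm_num
    rw [h1, h2]
    gcongr
    exact hmix.dev_le _
  have hlyap := fun n : ℕ => hmix.lyapunov_step_le hm hL hf hg
    (by linarith [Nat.cast_nonneg (α := ℝ) n] : (5 : ℝ) ≤ (n : ℝ) + 5) (hγ n) (hτ n) u
    (htrack n) (hA n)
  -- Deviations are rescaled by `γ` or `1 / τ` to make the recursions uniform in time. Each change
  -- of scale costs at most `36 / 25`, hence `3 ≥ 2 * 36 / 25` and `6 ≥ 4 * 36 / 25`; `40000` is `1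
  -- / (γ L τ) ^ 2`. The constant `15 / 4` is `w (w - 2) / 4` at the first step, `w = 5`.
  have hmain := consensus_error_bound (L := L)
    (B := 15 / 4 * (m * (objective f g (avg (A 0).y) - objective f g u))
        + 100 * L * frobSq ((A 0).z - constRows m u)) hL
    (Φ := fun n => ((n : ℝ) + 4) ^ 2 / 4 * (m * (objective f g (avg (A n).y) - objective f g u))
        + 100 * L * frobSq ((A n).z - constRows m u))
    (σ := fun n => γ n ^ 2 * frobSq (dev (A (n + 1)).s))
    (X := fun n => frobSq (dev (A (n + 1)).x) / τ n ^ 2)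
    (Y := fun n => frobSq (dev (A n).y) / τ n ^ 2)
    (Z := fun n => frobSq (dev (A n).z))
    (P := fun n => frobSq (dev (proxPoint mix f g (γ n) (τ n) (A n))))
    (D := fun n => m * ‖avg (A (n + 1)).z - avg (A n).z‖ ^ 2)
    (Q := fun n => γ n ^ 2 *
      frobSq (gradRows f (A (n + 1)).x - gradRows f (constRows m (avg (A n).y))))
    (fun n => mul_nonneg (sq_nonneg _) (frobSq_nonneg _))
    (fun n => div_nonneg (frobSq_nonneg _) (sq_nonneg _))
    (fun n => div_nonneg (frobSq_nonneg _) (sq_nonneg _))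
    (fun n => frobSq_nonneg _) (fun n => by positivity)
    (fun n => mul_nonneg (sq_nonneg _) (frobSq_nonneg _))
    (by simp [hdevy]) hdevz ?_ ?_ ?_ ?_ ?_ ?_ n
  · have h1 : 0 ≤ 100 * L * frobSq ((A (n + 1)).z - constRows m u) :=
      mul_nonneg (by positivity) (frobSq_nonneg _)
    have h2 := mul_le_mul_of_nonneg_left hσ0 (by positivity : 0 ≤ L * 300)
    have h3 : L * 300 * (25 / (160000 * L ^ 2) * (1 / 8192 * frobSq (dev (A 0).s)))
        = 1 / L * (300 * 25 / 160000 / 8192 * frobSq (dev (A 0).s)) := by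
      field_simp
    have h4 : 1 / L * (300 * 25 / 160000 / 8192 * frobSq (dev (A 0).s))
        ≤ 1 / L * (1 / 160000 * frobSq (dev (A 0).s)) := by
      refine mul_le_mul_of_nonneg_left ?_ (by positivity)
      linarith [frobSq_nonneg (dev (A 0).s)]
    simp only [Nat.cast_add, Nat.cast_one, zero_add] at hmain
    rw [show (n : ℝ) + 1 + 4 = n + 5 by ring] at hmain
    linarith
  · intro n
    have h := frobSq_dev_comb_le (τ n) (A n).z (A n).y
    have hx : (A (n + 1)).x = τ n • (A n).z + (1 - τ n) • (A n).y := by rw [hA]; rfl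
    have h1 := mul_le_mul_of_nonneg_right (hτ1 n) (frobSq_nonneg (dev (A n).y))
    have h2 := hτpos n
    simp only [hx]
    rw [div_le_iff₀ (by positivity), add_mul, mul_assoc 2 (_ / _), div_mul_cancel₀ _ (by positivity)]
    linarith
  · intro n
    simp only [hA n]
    exact hmix.dev_step_z_le _ _ _
  · intro n
    have h := hmix.dev_step_y_le (f := f) (g := g) (γ n) (τ n) (A n)
    rw [← hA] at h
    have h1 := mul_le_mul_of_nonneg_right (hτ1 n) (frobSq_nonneg (dev (A n).y))
    have h2 := hτpos n
    have h3 := hτpos (n + 1)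
    have h4 : frobSq (dev (A (n + 1)).y) ≤ 2 / 8192 *
        (τ n ^ 2 * (frobSq (dev (A (n + 1)).z) + frobSq (dev (A n).y) / τ n ^ 2)) := by
      rw [mul_add (τ n ^ 2), mul_div_cancel₀ _ (by positivity)]
      linarith
    have h5 : 0 ≤ frobSq (dev (A (n + 1)).z) + frobSq (dev (A n).y) / τ n ^ 2 :=
      add_nonneg (frobSq_nonneg _) (div_nonneg (frobSq_nonneg _) (sq_nonneg _))
    have h6 : τ n ^ 2 ≤ 36 / 25 * τ (n + 1) ^ 2 := by
      have := hτratio n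
      rwa [div_le_iff₀ (by positivity)] at this
    have h7 := mul_le_mul_of_nonneg_right h6 h5
    have h8 : 0 ≤ τ (n + 1) ^ 2 *
      (frobSq (dev (A (n + 1)).z) + frobSq (dev (A n).y) / τ n ^ 2) := by positivity
    rw [div_le_iff₀ (by positivity)]
    linarith
  · intro n
    have h := hmix.dev_step_step_s_le (g := g) hm hL hf (γ n) (τ n) (γ (n + 1)) (τ (n + 1))
      (A n) (A (n + 1)) (hA n)
    rw [← hA] at h
    have h2 := hτpos n
    have h3 := mul_le_mul_of_nonneg_left h (sq_nonneg (γ (n + 1)))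
    have h4 := mul_le_mul_of_nonneg_right (hratio n) (frobSq_nonneg (dev (A (n + 1)).s))
    set D := (m : ℝ) * ‖avg (A (n + 1)).z - avg (A n).z‖ ^ 2
    set X := frobSq (dev (A (n + 1)).x)
    have hD : 0 ≤ D := by positivity
    have hX : 0 ≤ X := frobSq_nonneg _
    have hQ : 0 ≤ γ (n + 1) ^ 2 * frobSq (gradRows f (A (n + 1 + 1)).x
      - gradRows f (constRows m (avg (A (n + 1)).y))) := mul_nonneg (sq_nonneg _) (frobSq_nonneg _)
    have hS : 0 ≤ γ n ^ 2 * frobSq (dev (A (n + 1)).s) :=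
      mul_nonneg (sq_nonneg _) (frobSq_nonneg _)
    have h5 : γ (n + 1) ^ 2 * (L ^ 2 * (τ n ^ 2 * D + X)) ≤ 36 / 25 * ((D + X / τ n ^ 2) / 40000) := by
      have h6 : γ n ^ 2 * (L ^ 2 * (τ n ^ 2 * D + X)) = (D + X / τ n ^ 2) / 40000 := by
        rw [hγτ]; field_simp; ring
      rw [← h6, ← mul_assoc (36 / 25 : ℝ)]
      gcongr
      exact hratio n
    have h7 : 0 ≤ (D + X / τ n ^ 2) / 40000 := by positivity
    linarith
  · have h := hlyap 0
    norm_num at h ⊢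
    linarith
  · intro n
    have h := hlyap (n + 1)
    -- Telescoping of the weights: `w (w - 2) ≤ (w - 1) ^ 2`, multiplied by a gap that is
    -- nonnegative because `u` is a minimizer.
    have h1 : ((n + 1 : ℕ) + 5 : ℝ) * ((n + 1 : ℕ) + 5 - 2) / 4
        * (m * (objective f g (avg (A (n + 1)).y) - objective f g u))
        ≤ ((n + 1 : ℕ) + 4 : ℝ) ^ 2 / 4
          * (m * (objective f g (avg (A (n + 1)).y) - objective f g u)) := by
      refine mul_le_mul_of_nonneg_right ?_ (hgap _)
      nlinarith
    have e : ((n + 1 : ℕ) + 5 : ℝ) = ((n + 2 : ℕ) + 4 : ℝ) := by push_cast; ring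
    rw [e] at h h1
    linarith

end ODAPG

end

theorem theorem2 {m d : ℕ} (hm : 2 ≤ m)
    (L : ℝ) (hL : 0 < L)
    (f : Fin m → ODAPG.Vec d → ℝ) (hf : ∀ i, ODAPG.IsConvexSmooth L (f i))
    (g : ODAPG.Vec d → ℝ) (hg : ConvexOn ℝ Set.univ g)
    (G : SimpleGraph (Fin m)) (W : Matrix (Fin m) (Fin m) ℝ) (hW : ODAPG.IsWeightMatrix G W)
    (lam : ℝ) (hlam : lam = ODAPG.lambda2 hm hW.posSemidef.isHermitian)
    (c_f : ℝ) (hc : c_f = 200)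
    (γ τ : ℕ → ℝ) (hγ : ∀ t, γ t = ((t : ℝ) + 4) / (2 * L * c_f))
    (hτ : ∀ t, τ t = 2 / ((t : ℝ) + 4))
    (K : ℕ) (hK : 15 / Real.sqrt (1 - lam) ≤ (K : ℝ))
    (x₁ xstar : ODAPG.Vec d) (hxstar : ∀ x, ODAPG.objective f g xstar ≤ ODAPG.objective f g x)
    (S : ℕ → ODAPG.State m d)
    (hS : S = ODAPG.run (fun x => ODAPG.fastMix W (ODAPG.mixParam lam) x K) f g γ τ x₁)
    (T : ℕ) (hT : 2 ≤ T) :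
    ODAPG.objective f g (ODAPG.avg (S T).y) - ODAPG.objective f g xstar ≤
      15 / ((T : ℝ) + 3) ^ 2 *
          (ODAPG.objective f g (ODAPG.avg (S 1).y) - ODAPG.objective f g xstar)
        + 2 * L * c_f / ((m : ℝ) * ((T : ℝ) + 3) ^ 2) *
          ODAPG.frobSq ((S 1).z - ODAPG.constRows m xstar)
        + 50 * L / ((m : ℝ) * ((T : ℝ) + 3) ^ 2) *
          (ODAPG.frobSq (ODAPG.mulRows (ODAPG.centering m) (S 1).x)
            + 9 * τ 1 ^ 2 / 32 * ODAPG.frobSq (ODAPG.mulRows (ODAPG.centering m) (S 1).z)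
            + 5 / (14 * L ^ 2 * c_f ^ 2) *
              ODAPG.frobSq (ODAPG.mulRows (ODAPG.centering m) (S 1).s)) := by
  subst hc
  have hm0 : 0 < m := by omega
  have hmR : (0 : ℝ) < m := by exact_mod_cast hm0
  obtain ⟨n, rfl⟩ : ∃ n, T = n + 2 := ⟨T - 2, by omega⟩
  have hmix : ODAPG.IsMixing (fun x : ODAPG.Rows m d =>
      ODAPG.fastMix W (ODAPG.mixParam lam) x K) :=
    ⟨fun x => hW.avg_fastMix _ x K, fun x => hW.frobSq_dev_fastMix_le hm hlam hK x⟩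
  have h := ODAPG.accelerated_rate hm0 hmix hL hf hg
    (γ := fun n => γ (n + 1)) (τ := fun n => τ (n + 1)) (x₁ := x₁) (A := fun n => S (n + 1))
    (fun n => by rw [hγ]; push_cast; ring_nf) (fun n => by rw [hτ]; push_cast; ring_nf)
    hxstar (by rw [hS]; rfl) (fun n => by rw [hS]; rfl) n
  simp only [zero_add, add_assoc, Nat.reduceAdd] at h
  simp only [ODAPG.mulRows_centering]
  rw [show ((n + 2 : ℕ) : ℝ) + 3 = n + 5 by push_cast; ring]
  set w : ℝ := n + 5
  have hw : 0 < w := by positivity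
  set a := ODAPG.objective f g (ODAPG.avg (S (n + 2)).y) - ODAPG.objective f g xstar
  set b := ODAPG.objective f g (ODAPG.avg (S 1).y) - ODAPG.objective f g xstar
  set q := ODAPG.frobSq ((S 1).z - ODAPG.constRows m xstar)
  have hX : 0 ≤ ODAPG.frobSq (ODAPG.dev (S 1).x) := ODAPG.frobSq_nonneg _
  have hZ : 0 ≤ ODAPG.frobSq (ODAPG.dev (S 1).z) := ODAPG.frobSq_nonneg _
  have hs : 0 ≤ ODAPG.frobSq (ODAPG.dev (S 1).s) := ODAPG.frobSq_nonneg _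
  set X := ODAPG.frobSq (ODAPG.dev (S 1).x)
  set Z := ODAPG.frobSq (ODAPG.dev (S 1).z)
  set s := ODAPG.frobSq (ODAPG.dev (S 1).s)
  -- The stated coefficient of the deviation of `s` amounts to `1 / 8960`, so there is room to
  -- spare; the `X` and `Z` terms enter only through nonnegativity.
  have hslack : 1 / L * (1 / 160000 * s)
      ≤ 50 * L / 4 * (X + 9 * τ 1 ^ 2 / 32 * Z + 5 / (14 * L ^ 2 * 200 ^ 2) * s) := by
    have h1 : 50 * L / 4 * (5 / (14 * L ^ 2 * 200 ^ 2) * s) = 1 / L * (1 / 8960 * s) := by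
      field_simp
      ring
    have h2 : 1 / L * (1 / 160000 * s) ≤ 1 / L * (1 / 8960 * s) := by
      gcongr
      norm_num
    have h3 : 0 ≤ 50 * L / 4 * (X + 9 * τ 1 ^ 2 / 32 * Z) := by positivity
    linarith
  refine le_of_mul_le_mul_left ?_ (by positivity : 0 < w ^ 2 / 4 * m)
  calc w ^ 2 / 4 * m * a = w ^ 2 / 4 * (m * a) := by ring
    _ ≤ 15 / 4 * (m * b) + 100 * L * q
        + 50 * L / 4 * (X + 9 * τ 1 ^ 2 / 32 * Z + 5 / (14 * L ^ 2 * 200 ^ 2) * s) := by linarith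
    _ = _ := by
      generalize X + 9 * τ 1 ^ 2 / 32 * Z + 5 / (14 * L ^ 2 * 200 ^ 2) * s = E
      field_simp
      ring
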